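/- Work with three qubits, held by Alice, Bob and Charlie. A GHZ-class state is a unit vector $|\psi\rangle\in\mathbb C^2\otimes\mathbb C^2\otimes\mathbb C^2$ of the form $|\psi\rangle=(A\otimes B\otimes C)\,\tfrac{1}{\sqrt2}(|000\rangle+|111\rangle)$ with invertible $2\times2$ matrices $A,B,C$. Such a state can be written as $|\psi\rangle=\tfrac1{\sqrt2}\left(\alpha|a_1b_1c_1\rangle+\beta|a_2b_2c_2\rangle\right)$ with $\alpha,\beta\in\mathbb C$ and unit vectors $a_j,b_j,c_j\in\mathbb C^2$, uniquely up to the order of the two terms and up to phases; its interference term is $I(\psi)=\operatorname{Re}\left(\alpha^*\beta\,\langle a_1b_1c_1|a_2b_2c_2\rangle\right)$. An LOCC protocol consists of finitely many rounds; in each round one party performs on its qubit a generalized measurement with finitely many Kraus operators $K_i$, $\sum_iK_i^\dagger K_i=\mathbb 1$, and announces the outcome, and the further course of the protocol may depend on all previous outcomes. If a branch has the accumulated Kraus operator $O$, its probability on the input $|\phi_i\rangle$ is $\|O|\phi_i\rangle\|^2$; the success probability of the protocol for the transformation $|\phi_i\rangle\to|\phi_s\rangle$ is the total probability of the branches for which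 $O|\phi_i\rangle$ is proportional to $|\phi_s\rangle$. **Lemma.** Let $|\phi_i\rangle$ and $|\phi_s\rangle$ be GHZ-class states with $I(\phi_i)\neq I(\phi_s)$. Then there is a constant $c<1$ (depending only on $|\phi_i\rangle$ and $|\phi_s\rangle$) such that every LOCC protocol transforms $|\phi_i\rangle$ into $|\phi_s\rangle$ with success probability at most $c$. In other words, the supremum of the success probability over all LOCC protocols is at most $c<1$. -/

import Mathlib

open scoped Kronecker ComplexConjugate

namespace TripartiteLOCC

/-- The state space of a single qubit. -/
abbrev Qubit : Type := EuclideanSpace ℂ (Fin 2)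

/-- The state space of three qubits (held by Alice, Bob and Charlie). -/
abbrev ThreeQubit : Type := EuclideanSpace ℂ (Fin 2 × Fin 2 × Fin 2)

/-- Operators on one qubit. -/
abbrev LocalMatrix : Type := Matrix (Fin 2) (Fin 2) ℂ

/-- The computational basis vectors `|0⟩`, `|1⟩` of a qubit. -/
noncomputable def ket (i : Fin 2) : Qubit := EuclideanSpace.single i 1

/-- The product vector `|a⟩ ⊗ |b⟩ ⊗ |c⟩`. -/
noncomputable def prodState (a b c : Qubit) : ThreeQubit :=
  WithLp.toLp 2 (fun x => a x.1 * b x.2.1 * c x.2.2)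

/-- The action of `A ⊗ B ⊗ C` on three-qubit vectors. -/
noncomputable def localApply (A B C : LocalMatrix) (ψ : ThreeQubit) : ThreeQubit :=
  Matrix.toEuclideanLin (A ⊗ₖ (B ⊗ₖ C)) ψ

/-- The GHZ state `(|000⟩ + |111⟩) / √2`. -/
noncomputable def ghz : ThreeQubit :=
  ((1 / Real.sqrt 2 : ℝ) : ℂ) •
    (prodState (ket 0) (ket 0) (ket 0) + prodState (ket 1) (ket 1) (ket 1))

/-- A (normalized) GHZ-class state: a unit vector that is equivalent to the GHZ state under
invertible local operators. -/
def IsGHZClass (ψ : ThreeQubit) : Prop :=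
  ‖ψ‖ = 1 ∧ ∃ A B C : LocalMatrix, IsUnit A ∧ IsUnit B ∧ IsUnit C ∧ ψ = localApply A B C ghz

/-- `I` is the interference term of `ψ`: writing
`ψ = (α |a₁ b₁ c₁⟩ + β |a₂ b₂ c₂⟩) / √2` with unit vectors `aᵢ, bᵢ, cᵢ`, it is the real part of
`α* β ⟨a₁ b₁ c₁ | a₂ b₂ c₂⟩`. For a GHZ-class state such a decomposition exists and is unique up
to exchanging the two terms and moving phases around, which does not affect the value. -/
def HasInterferenceTerm (ψ : ThreeQubit) (I : ℝ) : Prop :=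
  ∃ (α β : ℂ) (a₁ b₁ c₁ a₂ b₂ c₂ : Qubit),
    ‖a₁‖ = 1 ∧ ‖b₁‖ = 1 ∧ ‖c₁‖ = 1 ∧ ‖a₂‖ = 1 ∧ ‖b₂‖ = 1 ∧ ‖c₂‖ = 1 ∧
    ψ = ((1 / Real.sqrt 2 : ℝ) : ℂ) • (α • prodState a₁ b₁ c₁ + β • prodState a₂ b₂ c₂) ∧
    I = (conj α * β * inner ℂ (prodState a₁ b₁ c₁) (prodState a₂ b₂ c₂)).re

/-- The three parties. -/
inductive Party : Type
  | alice
  | bob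
  | charlie

/-- The operator `K` of one party, acting on the qubit of that party only. -/
noncomputable def Party.act : Party → LocalMatrix → ThreeQubit → ThreeQubit
  | .alice, K, ψ => localApply K 1 1 ψ
  | .bob, K, ψ => localApply 1 K 1 ψ
  | .charlie, K, ψ => localApply 1 1 K ψ

/-- An LOCC protocol with finitely many rounds. Either the protocol is over, or one party performs a generalized
measurement on its qubit, with finitely many Kraus operators `K i` satisfying
`∑ i, (K i)ᴴ * K i = 1`, and announces the outcome `i`, after which everybody goes on with the
protocol `next i`. Local unitaries (one outcome) and shared randomness
(multiples of the identity) are special cases. -/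
inductive LOCC : Type
  | done : LOCC
  | measure (party : Party) (n : ℕ) (K : Fin n → LocalMatrix)
      (complete : ∑ i, (K i).conjTranspose * K i = 1) (next : Fin n → LOCC) : LOCC

open scoped Classical in
/-- The total probability of the successful branches, i.e. of those that end in a vector
proportional to `target`. The argument `ψ` is the unnormalized current vector: a branch with
accumulated Kraus operator `O = A ⊗ B ⊗ C` turns the initial state `φ` into `O φ`, and has
probability `‖O φ‖ ^ 2`. -/
noncomputable def LOCC.successProb (target : ThreeQubit) : LOCC → ThreeQubit → ℝ
  | .done, ψ => if ∃ z : ℂ, ψ = z • target then ‖ψ‖ ^ 2 else 0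
  | .measure party _ K _ next, ψ =>
      ∑ i, LOCC.successProb target (next i) (party.act (K i) ψ)

end TripartiteLOCC

/-! Write a state as a sum `vec` of two product vectors `fst` and `snd`. Any one-party measurement
preserves, summed over outcomes, both `‖vec‖ ^ 2` and the interference, while the tangle (square
root of the modulus of the hyperdeterminant) cannot grow. Let `S` be the success probability;
successful leaves carry total interference `Is * S`, so failed leaves, of weight `1 - S`, must
account for the difference from `Ii`.

If `Ii > Is`, this is limited by `interference ≤ ‖vec‖ ^ 2 / 2`, valid for every vector.

If `Ii < Is`, a lower bound is needed, and interference relative to `‖vec‖ ^ 2` is bounded below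
only away from tangle zero. Let `δ` be half the target's tangle. While `δ * ‖vec‖ ^ 2 ≤ tangle`, the
local factors of all three parties have angles bounded away from zero, which gives a lower bound.
When a measurement first leaves this region, the other two parties' factors are untouched, so the
bound still holds there; by tangle monotonicity at most half of that branch's weight can succeed, so
its failure pays for the deficit. The recursion is `le_interference_of_protocol`. -/

namespace TripartiteLOCC

/-! ### Local operators, product vectors and measurement sums. -/

/-- The determinant of the matrix with columns `x` and `y`. -/
noncomputable def wedge (x y : Qubit) : ℂ := x 0 * y 1 - x 1 * y 0

/-- Cayley's hyperdeterminant of a three-qubit vector. -/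
noncomputable def hyperdet (ψ : ThreeQubit) : ℂ :=
  (ψ (0, 0, 0) * ψ (1, 1, 1) + ψ (0, 1, 1) * ψ (1, 0, 0)
      - ψ (0, 0, 1) * ψ (1, 1, 0) - ψ (0, 1, 0) * ψ (1, 0, 1)) ^ 2
    - 4 * (ψ (0, 0, 0) * ψ (0, 1, 1) - ψ (0, 0, 1) * ψ (0, 1, 0))
      * (ψ (1, 0, 0) * ψ (1, 1, 1) - ψ (1, 0, 1) * ψ (1, 1, 0))

lemma hyperdet_smul (z : ℂ) (ψ : ThreeQubit) : hyperdet (z • ψ) = z ^ 4 * hyperdet ψ := by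
  simp only [hyperdet, PiLp.smul_apply, smul_eq_mul]
  ring

/-- The action of a one-qubit operator on a one-qubit vector. -/
noncomputable def apply₁ (K : LocalMatrix) (x : Qubit) : Qubit := Matrix.toEuclideanLin K x

lemma apply₁_coord (K : LocalMatrix) (x : Qubit) (i : Fin 2) :
    apply₁ K x i = K i 0 * x 0 + K i 1 * x 1 := by
  fin_cases i <;> simp [apply₁, Matrix.toLpLin_apply]

lemma apply₁_one (x : Qubit) : apply₁ 1 x = x := by
  ext i; fin_cases i <;> simp [apply₁_coord]

lemma wedge_apply₁ (K : LocalMatrix) (x y : Qubit) :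
    wedge (apply₁ K x) (apply₁ K y) = K.det * wedge x y := by
  simp only [wedge, apply₁_coord, Matrix.det_fin_two]
  ring

lemma localApply_prodState (A B C : LocalMatrix) (a b c : Qubit) :
    localApply A B C (prodState a b c) = prodState (apply₁ A a) (apply₁ B b) (apply₁ C c) := by
  ext ⟨i, j, k⟩
  simp only [localApply, prodState, Matrix.toLpLin_apply, Matrix.mulVec, dotProduct,
    Fintype.sum_prod_type, Matrix.kroneckerMap_apply, Fin.sum_univ_two, apply₁_coord]
  ring

lemma localApply_add (A B C : LocalMatrix) (φ ψ : ThreeQubit) :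
    localApply A B C (φ + ψ) = localApply A B C φ + localApply A B C ψ :=
  map_add _ _ _

lemma localApply_smul (A B C : LocalMatrix) (z : ℂ) (ψ : ThreeQubit) :
    localApply A B C (z • ψ) = z • localApply A B C ψ :=
  map_smul _ _ _

lemma inner_qubit (x y : Qubit) : inner ℂ x y = conj (x 0) * y 0 + conj (x 1) * y 1 := by
  simp [PiLp.inner_apply, Fin.sum_univ_two, mul_comm]

lemma inner_prodState (a b c a' b' c' : Qubit) :
    inner ℂ (prodState a b c) (prodState a' b' c')
      = inner ℂ a a' * inner ℂ b b' * inner ℂ c c' := by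
  simp only [PiLp.inner_apply, Fintype.sum_prod_type, Fin.sum_univ_two, prodState,
    RCLike.inner_apply, map_mul]
  ring

lemma norm_prodState (a b c : Qubit) : ‖prodState a b c‖ = ‖a‖ * ‖b‖ * ‖c‖ := by
  have h := inner_prodState a b c a b c
  simp only [inner_self_eq_norm_sq_to_K] at h
  have h2 : ‖prodState a b c‖ ^ 2 = (‖a‖ * ‖b‖ * ‖c‖) ^ 2 := by
    rw [mul_pow, mul_pow]; exact_mod_cast h
  exact (pow_left_inj₀ (norm_nonneg _) (by positivity) two_ne_zero).1 h2

lemma norm_sq_qubit (x : Qubit) : ‖x‖ ^ 2 = ‖x 0‖ ^ 2 + ‖x 1‖ ^ 2 := by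
  simp [EuclideanSpace.norm_sq_eq, Fin.sum_univ_two]

lemma norm_sq_threeQubit (ψ : ThreeQubit) :
    ‖ψ‖ ^ 2 = ‖ψ (0, 0, 0)‖ ^ 2 + ‖ψ (0, 0, 1)‖ ^ 2 + ‖ψ (0, 1, 0)‖ ^ 2 + ‖ψ (0, 1, 1)‖ ^ 2
      + ‖ψ (1, 0, 0)‖ ^ 2 + ‖ψ (1, 0, 1)‖ ^ 2 + ‖ψ (1, 1, 0)‖ ^ 2 + ‖ψ (1, 1, 1)‖ ^ 2 := by
  simp only [EuclideanSpace.norm_sq_eq, Fintype.sum_prod_type, Fin.sum_univ_two]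
  ring

lemma sum_inner_apply₁ {n : ℕ} {K : Fin n → LocalMatrix}
    (hK : ∑ i, (K i).conjTranspose * K i = 1) (x y : Qubit) :
    ∑ i, inner ℂ (apply₁ (K i) x) (apply₁ (K i) y) = inner ℂ x y := by
  have h : ∀ j k, ∑ i, (conj (K i 0 j) * K i 0 k + conj (K i 1 j) * K i 1 k)
      = (1 : LocalMatrix) j k := by
    intro j k
    rw [← hK]
    simp [Matrix.sum_apply, Matrix.mul_apply, Fin.sum_univ_two]
  calc
    _ = ∑ i, (conj (x 0) * y 0 * (conj (K i 0 0) * K i 0 0 + conj (K i 1 0) * K i 1 0)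
          + conj (x 0) * y 1 * (conj (K i 0 0) * K i 0 1 + conj (K i 1 0) * K i 1 1)
          + conj (x 1) * y 0 * (conj (K i 0 1) * K i 0 0 + conj (K i 1 1) * K i 1 0)
          + conj (x 1) * y 1 * (conj (K i 0 1) * K i 0 1 + conj (K i 1 1) * K i 1 1)) := by
      refine Finset.sum_congr rfl fun i _ => ?_
      simp only [inner_qubit, apply₁_coord, map_add, map_mul]
      ring
    _ = _ := by
      simp only [Finset.sum_add_distrib, ← Finset.mul_sum] at h ⊢
      simp only [h]
      simp [inner_qubit]

lemma two_mul_norm_det_le (K : LocalMatrix) :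
    2 * ‖K.det‖ ≤ ((K.conjTranspose * K).trace).re := by
  have h : ((K.conjTranspose * K).trace).re
      = ‖K 0 0‖ ^ 2 + ‖K 1 0‖ ^ 2 + (‖K 0 1‖ ^ 2 + ‖K 1 1‖ ^ 2) := by
    simp [Matrix.trace, Matrix.mul_apply, Fin.sum_univ_two, Complex.sq_norm,
      Complex.normSq_apply]
  have h1 : ‖K.det‖ ≤ ‖K 0 0‖ * ‖K 1 1‖ + ‖K 0 1‖ * ‖K 1 0‖ := by
    rw [Matrix.det_fin_two, ← norm_mul, ← norm_mul]
    exact norm_sub_le _ _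
  rw [h]
  nlinarith [sq_nonneg (‖K 0 0‖ - ‖K 1 1‖), sq_nonneg (‖K 0 1‖ - ‖K 1 0‖)]

/-- The traces of the `(K i)ᴴ * K i` add up to `tr 1 = 2`, and each dominates twice `‖det‖`. This is
the source of tangle monotonicity. -/
lemma sum_norm_det_le {n : ℕ} {K : Fin n → LocalMatrix}
    (hK : ∑ i, (K i).conjTranspose * K i = 1) : ∑ i, ‖(K i).det‖ ≤ 1 := by
  have h : (∑ i, ((K i).conjTranspose * K i).trace).re = 2 := by
    rw [← Matrix.trace_sum, hK]; simp
  rw [Complex.re_sum] at h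
  have h2 := Finset.sum_le_sum fun i (_ : i ∈ Finset.univ) => two_mul_norm_det_le (K i)
  rw [h, ← Finset.mul_sum] at h2
  linarith

/-! ### Product pairs: quantities conserved or monotone under measurements. -/

/-- A pair of product vectors. -/
structure ProductPair where
  /-- Alice's factor of the first vector. -/
  a₁ : Qubit
  /-- Bob's factor of the first vector. -/
  b₁ : Qubit
  /-- Charlie's factor of the first vector. -/
  c₁ : Qubit
  /-- Alice's factor of the second vector. -/
  a₂ : Qubit
  /-- Bob's factor of the second vector. -/
  b₂ : Qubit
  /-- Charlie's factor of the second vector. -/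
  c₂ : Qubit

namespace ProductPair

/-- The first product vector. -/
noncomputable def fst (p : ProductPair) : ThreeQubit := prodState p.a₁ p.b₁ p.c₁

/-- The second product vector. -/
noncomputable def snd (p : ProductPair) : ThreeQubit := prodState p.a₂ p.b₂ p.c₂

/-- The sum of the two product vectors. -/
noncomputable def vec (p : ProductPair) : ThreeQubit := p.fst + p.snd

/-- The unnormalized interference term of the two product vectors. -/
noncomputable def interference (p : ProductPair) : ℝ := 2 * (inner ℂ p.fst p.snd).re

/-- The square root of the absolute value of the hyperdeterminant of the sum. -/
noncomputable def tangle (p : ProductPair) : ℝ :=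
  ‖wedge p.a₁ p.a₂‖ * ‖wedge p.b₁ p.b₂‖ * ‖wedge p.c₁ p.c₂‖

/-- The action of a one-qubit operator of one party. -/
noncomputable def act (p : ProductPair) : Party → LocalMatrix → ProductPair
  | .alice, K => { p with a₁ := apply₁ K p.a₁, a₂ := apply₁ K p.a₂ }
  | .bob, K => { p with b₁ := apply₁ K p.b₁, b₂ := apply₁ K p.b₂ }
  | .charlie, K => { p with c₁ := apply₁ K p.c₁, c₂ := apply₁ K p.c₂ }

lemma vec_act (p : ProductPair) (party : Party) (K : LocalMatrix) :
    (p.act party K).vec = party.act K p.vec := by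
  cases party <;>
    simp [act, vec, fst, snd, Party.act, localApply_add, localApply_prodState, apply₁_one]

lemma hyperdet_vec (p : ProductPair) :
    hyperdet p.vec = (wedge p.a₁ p.a₂ * wedge p.b₁ p.b₂ * wedge p.c₁ p.c₂) ^ 2 := by
  simp only [hyperdet, vec, fst, snd, prodState, wedge, PiLp.add_apply]
  ring

lemma tangle_nonneg (p : ProductPair) : 0 ≤ p.tangle := by unfold tangle; positivity

lemma tangle_sq (p : ProductPair) : p.tangle ^ 2 = ‖hyperdet p.vec‖ := by
  rw [hyperdet_vec, norm_pow, norm_mul, norm_mul, tangle]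

lemma tangle_act (p : ProductPair) (party : Party) (K : LocalMatrix) :
    (p.act party K).tangle = ‖K.det‖ * p.tangle := by
  cases party <;> simp only [act, tangle, wedge_apply₁, norm_mul] <;> ring

lemma sum_tangle_act_le (p : ProductPair) (party : Party) {n : ℕ} {K : Fin n → LocalMatrix}
    (hK : ∑ i, (K i).conjTranspose * K i = 1) : ∑ i, (p.act party (K i)).tangle ≤ p.tangle := by
  simp only [tangle_act, ← Finset.sum_mul]
  exact mul_le_of_le_one_left p.tangle_nonneg (sum_norm_det_le hK)

/-- The tangle depends on the sum alone, through the hyperdeterminant, which is homogeneous of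
degree 4. -/
lemma tangle_eq_of_vec_eq_smul {p q : ProductPair} {z : ℂ} (h : p.vec = z • q.vec) :
    p.tangle = ‖z‖ ^ 2 * q.tangle := by
  refine (pow_left_inj₀ p.tangle_nonneg
    (mul_nonneg (sq_nonneg _) q.tangle_nonneg) two_ne_zero).1 ?_
  rw [tangle_sq, h, hyperdet_smul, norm_mul, norm_pow, mul_pow, tangle_sq]
  ring

lemma norm_vec_sq (p : ProductPair) :
    ‖p.vec‖ ^ 2 = ‖p.fst‖ ^ 2 + ‖p.snd‖ ^ 2 + p.interference := by
  rw [vec, @norm_add_sq ℂ, interference]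
  simp only [RCLike.re_to_complex]
  ring

/-- Expand `0 ≤ ‖fst - snd‖ ^ 2` and compare with `‖fst + snd‖ ^ 2`. -/
lemma interference_le (p : ProductPair) : p.interference ≤ ‖p.vec‖ ^ 2 / 2 := by
  have h := @norm_sub_sq ℂ _ _ _ _ p.fst p.snd
  have h2 := sq_nonneg ‖p.fst - p.snd‖
  have h3 := p.norm_vec_sq
  simp only [RCLike.re_to_complex] at h
  unfold interference at *
  linarith

lemma sum_inner_act (p : ProductPair) (party : Party) {n : ℕ} {K : Fin n → LocalMatrix}
    (hK : ∑ i, (K i).conjTranspose * K i = 1) :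
    ∑ i, inner ℂ (p.act party (K i)).fst (p.act party (K i)).snd = inner ℂ p.fst p.snd := by
  cases party <;>
    simp only [act, fst, snd, inner_prodState, ← Finset.sum_mul, ← Finset.mul_sum,
      sum_inner_apply₁ hK]

lemma sum_interference_act (p : ProductPair) (party : Party) {n : ℕ} {K : Fin n → LocalMatrix}
    (hK : ∑ i, (K i).conjTranspose * K i = 1) :
    ∑ i, (p.act party (K i)).interference = p.interference := by
  simp only [interference, ← Finset.mul_sum, ← Complex.re_sum, sum_inner_act p party hK]

/-- The pair with the first vector repeated. -/
def dupFst (p : ProductPair) : ProductPair := ⟨p.a₁, p.b₁, p.c₁, p.a₁, p.b₁, p.c₁⟩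

/-- The pair with the two vectors exchanged. -/
def swap (p : ProductPair) : ProductPair := ⟨p.a₂, p.b₂, p.c₂, p.a₁, p.b₁, p.c₁⟩

lemma vec_swap (p : ProductPair) : p.swap.vec = p.vec := add_comm _ _

lemma swap_act (p : ProductPair) (party : Party) (K : LocalMatrix) :
    (p.act party K).swap = p.swap.act party K := by cases party <;> rfl

lemma sum_norm_fst_act_sq (p : ProductPair) (party : Party) {n : ℕ} {K : Fin n → LocalMatrix}
    (hK : ∑ i, (K i).conjTranspose * K i = 1) :
    ∑ i, ‖(p.act party (K i)).fst‖ ^ 2 = ‖p.fst‖ ^ 2 := by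
  have h := congrArg Complex.re (sum_inner_act p.dupFst party hK)
  have h1 : ∀ q : ProductPair, (inner ℂ q.fst q.fst).re = ‖q.fst‖ ^ 2 := fun q => by
    rw [inner_self_eq_norm_sq_to_K]; norm_cast
  rw [Complex.re_sum] at h
  rw [← h1 p]
  simp only [← h1]
  convert h using 2
  · cases party <;> rfl
  · rfl

lemma sum_norm_vec_act_sq (p : ProductPair) (party : Party) {n : ℕ} {K : Fin n → LocalMatrix}
    (hK : ∑ i, (K i).conjTranspose * K i = 1) :
    ∑ i, ‖(p.act party (K i)).vec‖ ^ 2 = ‖p.vec‖ ^ 2 := by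
  have h := sum_norm_fst_act_sq p.swap party hK
  simp only [← swap_act] at h
  simp only [norm_vec_sq, Finset.sum_add_distrib, sum_norm_fst_act_sq p party hK,
    sum_interference_act p party hK]
  congr 2

end ProductPair

/-! ### Large tangle separates local factors and bounds the interference below. -/

lemma wedge_swap (x y : Qubit) : wedge y x = -wedge x y := by
  simp only [wedge]; ring

lemma norm_wedge_swap (x y : Qubit) : ‖wedge y x‖ = ‖wedge x y‖ := by
  rw [wedge_swap, norm_neg]

lemma norm_mul_sub_mul_sq_le (x y s t : ℂ) :
    ‖x * t - y * s‖ ^ 2 ≤ (‖x‖ ^ 2 + ‖y‖ ^ 2) * (‖s‖ ^ 2 + ‖t‖ ^ 2) := by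
  have h : ‖x * t - y * s‖ ≤ ‖x‖ * ‖t‖ + ‖y‖ * ‖s‖ := by
    rw [← norm_mul, ← norm_mul]
    exact norm_sub_le _ _
  have h2 := pow_le_pow_left₀ (norm_nonneg _) h 2
  nlinarith [sq_nonneg (‖x‖ * ‖s‖ - ‖y‖ * ‖t‖)]

lemma norm_pos_of_wedge_ne_zero {x y : Qubit} (h : wedge x y ≠ 0) : 0 < ‖x‖ ∧ 0 < ‖y‖ := by
  constructor <;> refine norm_pos_iff.2 ?_ <;> rintro rfl <;> simp [wedge] at h

namespace ProductPair

lemma norm_fst (p : ProductPair) : ‖p.fst‖ = ‖p.a₁‖ * ‖p.b₁‖ * ‖p.c₁‖ := norm_prodState _ _ _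

lemma vec_coord (p : ProductPair) (i j k : Fin 2) :
    p.vec (i, j, k) = p.a₁ i * p.b₁ j * p.c₁ k + p.a₂ i * p.b₂ j * p.c₂ k := rfl

/-- Contracting Alice's index with `wedge · a₂` kills the second product vector and leaves a
multiple of `b₁ ⊗ c₁`; Cauchy–Schwarz bounds the result. -/
lemma contract_alice (p : ProductPair) :
    ‖p.b₁‖ * ‖p.c₁‖ * ‖wedge p.a₁ p.a₂‖ ≤ ‖p.a₂‖ * ‖p.vec‖ := by
  refine (pow_le_pow_iff_left₀ (by positivity) (by positivity) two_ne_zero).1 ?_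
  have h : ∀ j k, ‖p.b₁ j‖ ^ 2 * ‖p.c₁ k‖ ^ 2 * ‖wedge p.a₁ p.a₂‖ ^ 2
      ≤ (‖p.vec (0, j, k)‖ ^ 2 + ‖p.vec (1, j, k)‖ ^ 2) * ‖p.a₂‖ ^ 2 := fun j k => by
    rw [norm_sq_qubit p.a₂, ← mul_pow, ← mul_pow, ← norm_mul, ← norm_mul]
    convert norm_mul_sub_mul_sq_le _ _ _ _ using 3
    rw [vec_coord, vec_coord, wedge]
    ring
  simp only [mul_pow, norm_sq_qubit p.b₁, norm_sq_qubit p.c₁, norm_sq_threeQubit]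
  linarith [h 0 0, h 0 1, h 1 0, h 1 1]

lemma contract_bob (p : ProductPair) :
    ‖p.a₁‖ * ‖p.c₁‖ * ‖wedge p.b₁ p.b₂‖ ≤ ‖p.b₂‖ * ‖p.vec‖ := by
  refine (pow_le_pow_iff_left₀ (by positivity) (by positivity) two_ne_zero).1 ?_
  have h : ∀ j k, ‖p.a₁ j‖ ^ 2 * ‖p.c₁ k‖ ^ 2 * ‖wedge p.b₁ p.b₂‖ ^ 2
      ≤ (‖p.vec (j, 0, k)‖ ^ 2 + ‖p.vec (j, 1, k)‖ ^ 2) * ‖p.b₂‖ ^ 2 := fun j k => by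
    rw [norm_sq_qubit p.b₂, ← mul_pow, ← mul_pow, ← norm_mul, ← norm_mul]
    convert norm_mul_sub_mul_sq_le _ _ _ _ using 3
    rw [vec_coord, vec_coord, wedge]
    ring
  simp only [mul_pow, norm_sq_qubit p.a₁, norm_sq_qubit p.c₁, norm_sq_threeQubit]
  linarith [h 0 0, h 0 1, h 1 0, h 1 1]

lemma contract_charlie (p : ProductPair) :
    ‖p.a₁‖ * ‖p.b₁‖ * ‖wedge p.c₁ p.c₂‖ ≤ ‖p.c₂‖ * ‖p.vec‖ := by
  refine (pow_le_pow_iff_left₀ (by positivity) (by positivity) two_ne_zero).1 ?_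
  have h : ∀ j k, ‖p.a₁ j‖ ^ 2 * ‖p.b₁ k‖ ^ 2 * ‖wedge p.c₁ p.c₂‖ ^ 2
      ≤ (‖p.vec (j, k, 0)‖ ^ 2 + ‖p.vec (j, k, 1)‖ ^ 2) * ‖p.c₂‖ ^ 2 := fun j k => by
    rw [norm_sq_qubit p.c₂, ← mul_pow, ← mul_pow, ← norm_mul, ← norm_mul]
    convert norm_mul_sub_mul_sq_le _ _ _ _ using 3
    rw [vec_coord, vec_coord, wedge]
    ring
  simp only [mul_pow, norm_sq_qubit p.a₁, norm_sq_qubit p.b₁, norm_sq_threeQubit]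
  linarith [h 0 0, h 0 1, h 1 0, h 1 1]

end ProductPair

/-- Two nonzero vectors such that the sine of the angle between them is at least `δ`. -/
def Spread (δ : ℝ) (x y : Qubit) : Prop :=
  0 < ‖x‖ ∧ 0 < ‖y‖ ∧ δ * (‖x‖ * ‖y‖) ≤ ‖wedge x y‖

lemma Spread.swap {δ : ℝ} {x y : Qubit} (h : Spread δ x y) : Spread δ y x :=
  ⟨h.2.1, h.1, by rw [norm_wedge_swap, mul_comm ‖y‖]; exact h.2.2⟩

/-- Multiplying the four contraction bounds of two parties gives `a₁ * a₂ * wb * wc ≤ n ^ 2`;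
comparison with the tangle bound lets `wb * wc` cancel. -/
lemma mul_le_of_contractions {δ a₁ a₂ b₁ b₂ c₁ c₂ wa wb wc n : ℝ}
    (hδ : 0 < δ) (ha₁ : 0 < a₁) (ha₂ : 0 < a₂) (hb₁ : 0 < b₁) (hb₂ : 0 < b₂) (hc₁ : 0 < c₁)
    (hc₂ : 0 < c₂) (hwb : 0 < wb) (hwc : 0 < wc) (hn : 0 ≤ n)
    (h₁ : a₁ * c₁ * wb ≤ b₂ * n) (h₂ : a₂ * c₂ * wb ≤ b₁ * n)
    (h₃ : a₁ * b₁ * wc ≤ c₂ * n) (h₄ : a₂ * b₂ * wc ≤ c₁ * n)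
    (h : δ * n ^ 2 ≤ wa * wb * wc) : δ * (a₁ * a₂) ≤ wa := by
  have h12 := mul_le_mul h₁ h₂ (by positivity) (by positivity)
  have h34 := mul_le_mul h₃ h₄ (by positivity) (by positivity)
  have h14 := mul_le_mul h12 h34 (by positivity) (by positivity)
  have key : (a₁ * a₂ * wb * wc) ^ 2 ≤ (n ^ 2) ^ 2 := by
    refine le_of_mul_le_mul_left (a := b₁ * b₂ * c₁ * c₂) ?_ (by positivity)
    linarith
  have key2 := (pow_le_pow_iff_left₀ (by positivity) (by positivity) two_ne_zero).1 key
  refine le_of_mul_le_mul_right (a := wb * wc) ?_ (by positivity)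
  have := mul_le_mul_of_nonneg_left key2 hδ.le
  linarith

namespace ProductPair

lemma spread_of_le_tangle {p : ProductPair} {δ : ℝ} (hδ : 0 < δ) (hp : 0 < ‖p.vec‖ ^ 2)
    (h : δ * ‖p.vec‖ ^ 2 ≤ p.tangle) :
    Spread δ p.a₁ p.a₂ ∧ Spread δ p.b₁ p.b₂ ∧ Spread δ p.c₁ p.c₂ := by
  have hT : 0 < p.tangle := lt_of_lt_of_le (by positivity) h
  have hwa : wedge p.a₁ p.a₂ ≠ 0 := by rintro h; simp [tangle, h] at hT
  have hwb : wedge p.b₁ p.b₂ ≠ 0 := by rintro h; simp [tangle, h] at hT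
  have hwc : wedge p.c₁ p.c₂ ≠ 0 := by rintro h; simp [tangle, h] at hT
  obtain ⟨ha₁, ha₂⟩ := norm_pos_of_wedge_ne_zero hwa
  obtain ⟨hb₁, hb₂⟩ := norm_pos_of_wedge_ne_zero hwb
  obtain ⟨hc₁, hc₂⟩ := norm_pos_of_wedge_ne_zero hwc
  have A₁ := p.contract_alice
  have B₁ := p.contract_bob
  have C₁ := p.contract_charlie
  have A₂ : ‖p.b₂‖ * ‖p.c₂‖ * ‖wedge p.a₁ p.a₂‖ ≤ ‖p.a₁‖ * ‖p.vec‖ := by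
    rw [← p.vec_swap, ← norm_wedge_swap]; exact p.swap.contract_alice
  have B₂ : ‖p.a₂‖ * ‖p.c₂‖ * ‖wedge p.b₁ p.b₂‖ ≤ ‖p.b₁‖ * ‖p.vec‖ := by
    rw [← p.vec_swap, ← norm_wedge_swap]; exact p.swap.contract_bob
  have C₂ : ‖p.a₂‖ * ‖p.b₂‖ * ‖wedge p.c₁ p.c₂‖ ≤ ‖p.c₁‖ * ‖p.vec‖ := by
    rw [← p.vec_swap, ← norm_wedge_swap]; exact p.swap.contract_charlie
  have pa := norm_pos_iff.2 hwa
  have pb := norm_pos_iff.2 hwb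
  have pc := norm_pos_iff.2 hwc
  have n0 := norm_nonneg p.vec
  unfold tangle at h
  refine ⟨⟨ha₁, ha₂, ?_⟩, ⟨hb₁, hb₂, ?_⟩, ⟨hc₁, hc₂, ?_⟩⟩
  · exact mul_le_of_contractions hδ ha₁ ha₂ hb₁ hb₂ hc₁ hc₂ pb pc n0 B₁ B₂ C₁ C₂ h
  · exact mul_le_of_contractions hδ hb₁ hb₂ ha₁ ha₂ hc₁ hc₂ pa pc n0 A₁ A₂
      (by linarith) (by linarith) (by linarith)
  · exact mul_le_of_contractions hδ hc₁ hc₂ ha₁ ha₂ hb₁ hb₂ pa pb n0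
      (by linarith) (by linarith) (by linarith) (by linarith) (by linarith)

lemma norm_fst_le_of_spread {p : ProductPair} {δ : ℝ}
    (h : Spread δ p.a₁ p.a₂ ∨ Spread δ p.b₁ p.b₂ ∨ Spread δ p.c₁ p.c₂) :
    δ * ‖p.fst‖ ≤ ‖p.vec‖ := by
  rw [norm_fst]
  rcases h with ⟨-, h0, h⟩ | ⟨-, h0, h⟩ | ⟨-, h0, h⟩ <;> refine le_of_mul_le_mul_left ?_ h0
  · have := mul_le_mul_of_nonneg_left h (by positivity : 0 ≤ ‖p.b₁‖ * ‖p.c₁‖)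
    linarith [p.contract_alice]
  · have := mul_le_mul_of_nonneg_left h (by positivity : 0 ≤ ‖p.a₁‖ * ‖p.c₁‖)
    linarith [p.contract_bob]
  · have := mul_le_mul_of_nonneg_left h (by positivity : 0 ≤ ‖p.a₁‖ * ‖p.b₁‖)
    linarith [p.contract_charlie]

/-- A single separated party suffices to bound both product vectors by `‖vec‖ / δ`, and the
interference is `‖vec‖ ^ 2 - ‖fst‖ ^ 2 - ‖snd‖ ^ 2`. -/
lemma neg_mul_le_interference {p : ProductPair} {δ : ℝ} (hδ : 0 < δ)
    (h : Spread δ p.a₁ p.a₂ ∨ Spread δ p.b₁ p.b₂ ∨ Spread δ p.c₁ p.c₂) :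
    -(2 / δ ^ 2 * ‖p.vec‖ ^ 2) ≤ p.interference := by
  have h1 := norm_fst_le_of_spread h
  have h2 : δ * ‖p.snd‖ ≤ ‖p.vec‖ := by
    rw [← p.vec_swap]
    exact norm_fst_le_of_spread (p := p.swap) (h.imp Spread.swap (Or.imp Spread.swap Spread.swap))
  have h1' := pow_le_pow_left₀ (by positivity) h1 2
  have h2' := pow_le_pow_left₀ (by positivity) h2 2
  rw [mul_pow, ← le_div_iff₀' (by positivity)] at h1' h2'
  have h3 := p.norm_vec_sq
  have h4 : 2 / δ ^ 2 * ‖p.vec‖ ^ 2 = ‖p.vec‖ ^ 2 / δ ^ 2 + ‖p.vec‖ ^ 2 / δ ^ 2 := by ring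
  linarith [sq_nonneg ‖p.vec‖]

/-- The tangle hypothesis is on the state before the measurement: whatever `K` does, some other
party's factors stay separated. -/
lemma neg_mul_le_interference_act {p : ProductPair} {δ : ℝ} (hδ : 0 < δ)
    (hp : 0 < ‖p.vec‖ ^ 2) (h : δ * ‖p.vec‖ ^ 2 ≤ p.tangle) (party : Party) (K : LocalMatrix) :
    -(2 / δ ^ 2 * ‖(p.act party K).vec‖ ^ 2) ≤ (p.act party K).interference := by
  obtain ⟨ha, hb, hc⟩ := spread_of_le_tangle hδ hp h
  refine neg_mul_le_interference hδ ?_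
  cases party
  exacts [Or.inr (Or.inl hb), Or.inl ha, Or.inl ha]

/-! ### Uniqueness of the decomposition, so that interference depends only on the vector. -/

lemma fst_eq_of_wedge_eq_zero {p q : ProductPair} (h : p.vec = q.vec)
    (hq : wedge q.a₁ q.a₂ ≠ 0) (h₁ : wedge q.a₁ p.a₁ = 0) (h₂ : wedge q.a₂ p.a₂ = 0) :
    p.fst = q.fst := by
  have hc : ∀ i j k, p.a₁ i * p.b₁ j * p.c₁ k + p.a₂ i * p.b₂ j * p.c₂ k
      = q.a₁ i * q.b₁ j * q.c₁ k + q.a₂ i * q.b₂ j * q.c₂ k := fun i j k => by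
    rw [← vec_coord, ← vec_coord, h]
  have key : ∀ j k, wedge p.a₁ q.a₂ * p.b₁ j * p.c₁ k = wedge q.a₁ q.a₂ * q.b₁ j * q.c₁ k := by
    intro j k
    unfold wedge at h₂ ⊢
    linear_combination q.a₂ 1 * hc 0 j k - q.a₂ 0 * hc 1 j k + h₂ * p.b₂ j * p.c₂ k
  have cramer : ∀ i, wedge q.a₁ q.a₂ * p.a₁ i = wedge p.a₁ q.a₂ * q.a₁ i := by
    intro i
    unfold wedge at h₁ ⊢
    fin_cases i
    · simp only [Fin.zero_eta]
      linear_combination q.a₂ 0 * h₁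
    · simp only [Fin.mk_one]
      linear_combination q.a₂ 1 * h₁
  ext ⟨i, j, k⟩
  refine mul_left_cancel₀ hq ?_
  simp only [fst, prodState]
  linear_combination p.b₁ j * p.c₁ k * cramer i + q.a₁ i * key j k

lemma eq_or_eq_swap_of_vec_eq {p q : ProductPair} (h : p.vec = q.vec) (hq : 0 < q.tangle) :
    (p.fst = q.fst ∧ p.snd = q.snd) ∨ (p.fst = q.snd ∧ p.snd = q.fst) := by
  have hp : 0 < p.tangle := by
    rw [tangle_eq_of_vec_eq_smul (z := 1) (h.trans (one_smul _ _).symm)]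
    simpa using hq
  have qa : wedge q.a₁ q.a₂ ≠ 0 := by rintro h; simp [tangle, h] at hq
  have pa : wedge p.a₁ p.a₂ ≠ 0 := by rintro h; simp [tangle, h] at hp
  have pb : wedge p.b₁ p.b₂ ≠ 0 := by rintro h; simp [tangle, h] at hp
  have pc : wedge p.c₁ p.c₂ ≠ 0 := by rintro h; simp [tangle, h] at hp
  have parallel : ∀ q : ProductPair, p.vec = q.vec →
      wedge q.a₁ p.a₁ = 0 ∨ wedge q.a₁ p.a₂ = 0 := by
    intro q h
    have hc : ∀ j k, wedge q.a₁ p.a₁ * p.b₁ j * p.c₁ k + wedge q.a₁ p.a₂ * p.b₂ j * p.c₂ k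
        = wedge q.a₁ q.a₂ * q.b₂ j * q.c₂ k := fun j k => by
      have h0 := vec_coord p 0 j k
      have h1 := vec_coord p 1 j k
      rw [h, vec_coord] at h0 h1
      unfold wedge
      linear_combination q.a₁ 1 * h0 - q.a₁ 0 * h1
    -- Contraction with `q.a₁` leaves a rank-one Bob–Charlie matrix on the `q` side, so its
    -- determinant, computed from `p`, vanishes.
    have hdet : wedge q.a₁ p.a₁ * wedge q.a₁ p.a₂ * (wedge p.b₁ p.b₂ * wedge p.c₁ p.c₂) = 0 := by
      generalize wedge q.a₁ p.a₁ = s at *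
      generalize wedge q.a₁ p.a₂ = t at *
      calc
        _ = (s * p.b₁ 0 * p.c₁ 0 + t * p.b₂ 0 * p.c₂ 0) * (s * p.b₁ 1 * p.c₁ 1 + t * p.b₂ 1 * p.c₂ 1)
            - (s * p.b₁ 0 * p.c₁ 1 + t * p.b₂ 0 * p.c₂ 1)
              * (s * p.b₁ 1 * p.c₁ 0 + t * p.b₂ 1 * p.c₂ 0) := by unfold wedge; ring
        _ = 0 := by rw [hc, hc, hc, hc]; ring
    simpa [pb, pc] using hdet
  have cross : ∀ x y : Qubit, wedge q.a₁ x = 0 → wedge q.a₂ x = 0 → wedge x y = 0 := by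
    intro x y h1 h2
    refine (mul_eq_zero.1 ?_).resolve_left qa
    unfold wedge at *
    linear_combination (q.a₂ 0 * y 1 - q.a₂ 1 * y 0) * h1 - (q.a₁ 0 * y 1 - q.a₁ 1 * y 0) * h2
  have hsnd : p.fst + p.snd = q.fst + q.snd := h
  have h2 : wedge q.a₂ p.a₁ = 0 ∨ wedge q.a₂ p.a₂ = 0 :=
    parallel q.swap (h.trans q.vec_swap.symm)
  rcases parallel q h with h₁ | h₁
  · left
    have hf := fst_eq_of_wedge_eq_zero h qa h₁ (h2.resolve_left fun h' => pa (cross _ _ h₁ h'))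
    exact ⟨hf, by rwa [hf, add_right_inj] at hsnd⟩
  · right
    have h2' := h2.resolve_right fun h' => pa (by
      rw [wedge_swap, cross _ _ h₁ h', neg_zero])
    have hf : p.snd = q.fst := fst_eq_of_wedge_eq_zero (p := p.swap) (p.vec_swap.trans h) qa h₁ h2'
    exact ⟨by rwa [hf, add_comm, add_right_inj] at hsnd, hf⟩

lemma interference_eq_of_vec_eq {p q : ProductPair} (h : p.vec = q.vec) (hq : 0 < q.tangle) :
    p.interference = q.interference := by
  have hp := p.norm_vec_sq
  have hq' := q.norm_vec_sq
  rw [h] at hp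
  rcases eq_or_eq_swap_of_vec_eq h hq with ⟨h1, h2⟩ | ⟨h1, h2⟩ <;> rw [h1, h2] at hp <;> linarith

/-- Multiplication of both product vectors by a scalar. -/
noncomputable def scale (z : ℂ) (p : ProductPair) : ProductPair :=
  { p with a₁ := z • p.a₁, a₂ := z • p.a₂ }

lemma fst_scale (z : ℂ) (p : ProductPair) : (p.scale z).fst = z • p.fst := by
  ext ⟨i, j, k⟩
  simp [scale, fst, prodState, mul_assoc]

lemma snd_scale (z : ℂ) (p : ProductPair) : (p.scale z).snd = z • p.snd := by
  ext ⟨i, j, k⟩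
  simp [scale, snd, prodState, mul_assoc]

lemma vec_scale (z : ℂ) (p : ProductPair) : (p.scale z).vec = z • p.vec := by
  rw [vec, fst_scale, snd_scale, vec, smul_add]

lemma interference_scale (z : ℂ) (p : ProductPair) :
    (p.scale z).interference = ‖z‖ ^ 2 * p.interference := by
  have h := (p.scale z).norm_vec_sq
  rw [vec_scale, fst_scale, snd_scale, norm_smul, norm_smul, norm_smul] at h
  linear_combination -h + ‖z‖ ^ 2 * p.norm_vec_sq

lemma interference_eq_of_vec_eq_smul {p q : ProductPair} {z : ℂ} (hz : z ≠ 0)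
    (h : p.vec = z • q.vec) (hq : 0 < q.tangle) :
    p.interference = ‖z‖ ^ 2 * q.interference := by
  rw [← vec_scale] at h
  rw [← interference_scale]
  refine interference_eq_of_vec_eq h ?_
  rw [tangle_eq_of_vec_eq_smul (q.vec_scale z)]
  have := norm_pos_iff.2 hz
  positivity

end ProductPair

/-! ### From GHZ-class states to product pairs of positive tangle. -/

lemma IsGHZClass.hyperdet_ne_zero {ψ : ThreeQubit} (h : IsGHZClass ψ) : hyperdet ψ ≠ 0 := by
  obtain ⟨-, A, B, C, hA, hB, hC, rfl⟩ := h
  rw [Matrix.isUnit_iff_isUnit_det, isUnit_iff_ne_zero] at hA hB hC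
  have hw : wedge (ket 0) (ket 1) = 1 := by simp [wedge, ket]
  have h := ProductPair.hyperdet_vec ⟨apply₁ A (ket 0), apply₁ B (ket 0), apply₁ C (ket 0),
    apply₁ A (ket 1), apply₁ B (ket 1), apply₁ C (ket 1)⟩
  simp only [ProductPair.vec, ProductPair.fst, ProductPair.snd, wedge_apply₁, hw] at h
  rw [ghz, localApply_smul, localApply_add, localApply_prodState, localApply_prodState,
    hyperdet_smul, h]
  have h2 : ((1 / Real.sqrt 2 : ℝ) : ℂ) ≠ 0 := by
    rw [Complex.ofReal_ne_zero]; positivity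
  exact mul_ne_zero (pow_ne_zero _ h2) (by simp [hA, hB, hC])

lemma HasInterferenceTerm.exists_pair {ψ : ThreeQubit} {I : ℝ} (h : HasInterferenceTerm ψ I)
    (hψ : IsGHZClass ψ) :
    ∃ p : ProductPair, p.vec = ψ ∧ p.interference = I ∧ 0 < p.tangle := by
  obtain ⟨α, β, a₁, b₁, c₁, a₂, b₂, c₂, -, -, -, -, -, -, hvec, hI⟩ := h
  set r : ℂ := ((1 / Real.sqrt 2 : ℝ) : ℂ) with hr
  have hv : ProductPair.vec ⟨(r * α) • a₁, b₁, c₁, (r * β) • a₂, b₂, c₂⟩ = ψ := by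
    rw [hvec]
    ext ⟨i, j, k⟩
    simp [ProductPair.vec, ProductPair.fst, ProductPair.snd, prodState]
    ring
  refine ⟨_, hv, ?_, ?_⟩
  · have hrr : conj r * r = ((1 / 2 : ℝ) : ℂ) := by
      rw [hr, Complex.conj_ofReal, ← Complex.ofReal_mul]
      congr 1
      rw [div_mul_div_comm, Real.mul_self_sqrt (by norm_num), one_mul]
    rw [hI, ProductPair.interference, ProductPair.fst, ProductPair.snd, inner_prodState,
      inner_prodState, inner_smul_left, inner_smul_right]
    have : conj (r * α) * (r * β * inner ℂ a₁ a₂) * inner ℂ b₁ b₂ * inner ℂ c₁ c₂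
        = ((1 / 2 : ℝ) : ℂ) * (conj α * β * (inner ℂ a₁ a₂ * inner ℂ b₁ b₂ * inner ℂ c₁ c₂)) := by
      rw [← hrr, map_mul]; ring
    rw [this, Complex.re_ofReal_mul]
    ring
  · refine lt_of_pow_lt_pow_left₀ 2 (ProductPair.tangle_nonneg _) ?_
    rw [zero_pow two_ne_zero, ProductPair.tangle_sq, hv]
    exact norm_pos_iff.2 hψ.hyperdet_ne_zero

/-! ### Induction over protocols. -/

open ProductPair

namespace LOCC

lemma successProb_measure (target : ThreeQubit) (party : Party) {n : ℕ} (K : Fin n → LocalMatrix)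
    (hK : ∑ i, (K i).conjTranspose * K i = 1) (next : Fin n → LOCC) (p : ProductPair) :
    (measure party n K hK next).successProb target p.vec
      = ∑ i, (next i).successProb target (p.act party (K i)).vec := by
  simp only [successProb, vec_act]

lemma successProb_mul_tangle_le {s : ProductPair} (hs : ‖s.vec‖ = 1) (P : LOCC)
    (p : ProductPair) : P.successProb s.vec p.vec * s.tangle ≤ p.tangle := by
  induction P generalizing p with
  | done =>
    rw [successProb]
    split_ifs with h
    · obtain ⟨z, hz⟩ := h
      rw [tangle_eq_of_vec_eq_smul hz, hz, norm_smul, hs, mul_one]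
    · rw [zero_mul]; exact p.tangle_nonneg
  | measure party n K hK next ih =>
    rw [successProb_measure, Finset.sum_mul]
    exact (Finset.sum_le_sum fun i _ => ih i _).trans (p.sum_tangle_act_le party hK)

lemma interference_le_of_protocol {s : ProductPair} (hs : ‖s.vec‖ = 1) (hT : 0 < s.tangle)
    (P : LOCC) (p : ProductPair) :
    p.interference ≤ s.interference * P.successProb s.vec p.vec
      + (‖p.vec‖ ^ 2 - P.successProb s.vec p.vec) / 2 := by
  induction P generalizing p with
  | done =>
    rw [successProb]
    split_ifs with h
    · obtain ⟨z, hz⟩ := h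
      by_cases hz0 : z = 0
      · simpa [hz, hz0] using p.interference_le
      · rw [interference_eq_of_vec_eq_smul hz0 hz hT, hz, norm_smul, hs]
        linarith
    · simpa using p.interference_le
  | measure party n K hK next ih =>
    rw [successProb_measure, ← p.sum_interference_act party hK, ← p.sum_norm_vec_act_sq party hK,
      ← Finset.sum_sub_distrib, Finset.mul_sum, Finset.sum_div, ← Finset.sum_add_distrib]
    exact Finset.sum_le_sum fun i _ => ih i _

/-- `C` is the price per unit of failed weight. The factor 2 in `hC` is there because possibly only
half of the weight fails on a branch leaving the large-tangle region. -/
lemma le_interference_of_protocol {s : ProductPair} (hs : ‖s.vec‖ = 1) {δ : ℝ}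
    (hδ : 0 < δ) (hδs : 2 * δ = s.tangle) {C : ℝ} (hC : 2 / δ ^ 2 * 2 + |s.interference| ≤ C)
    (P : LOCC) (p : ProductPair) (hp : 0 < ‖p.vec‖ ^ 2) (hpT : δ * ‖p.vec‖ ^ 2 ≤ p.tangle) :
    s.interference * P.successProb s.vec p.vec - C * (‖p.vec‖ ^ 2 - P.successProb s.vec p.vec)
      ≤ p.interference := by
  have hT : 0 < s.tangle := by linarith
  have hδ2 : 0 < 2 / δ ^ 2 := by positivity
  have hI := abs_le.1 (le_refl |s.interference|)
  induction P generalizing p with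
  | done =>
    rw [successProb]
    split_ifs with h
    · obtain ⟨z, hz⟩ := h
      have hz0 : z ≠ 0 := by rintro rfl; simp [hz] at hp
      rw [interference_eq_of_vec_eq_smul hz0 hz hT, hz, norm_smul, hs]
      linarith
    · have h1 := neg_mul_le_interference hδ (Or.inl (spread_of_le_tangle hδ hp hpT).1)
      have h2 := mul_le_mul_of_nonneg_right
        (by linarith [abs_nonneg s.interference] : 2 / δ ^ 2 ≤ C) hp.le
      linarith
  | measure party n K hK next ih =>
    rw [successProb_measure, ← p.sum_interference_act party hK, ← p.sum_norm_vec_act_sq party hK,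
      ← Finset.sum_sub_distrib, Finset.mul_sum, Finset.mul_sum, ← Finset.sum_sub_distrib]
    refine Finset.sum_le_sum fun i _ => ?_
    by_cases hgood : 0 < ‖(p.act party (K i)).vec‖ ^ 2 ∧
        δ * ‖(p.act party (K i)).vec‖ ^ 2 ≤ (p.act party (K i)).tangle
    · exact ih i _ hgood.1 hgood.2
    -- On leaving the region the induction hypothesis is unavailable; the one-step interference
    -- bound and the tangle bound on success replace it.
    · have h1 := neg_mul_le_interference_act hδ hp hpT party (K i)
      have h2 := successProb_mul_tangle_le hs (next i) (p.act party (K i))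
      set q := p.act party (K i)
      set S := (next i).successProb s.vec q.vec
      have hN := sq_nonneg ‖q.vec‖
      have hqT : q.tangle ≤ δ * ‖q.vec‖ ^ 2 := by
        rcases hN.lt_or_eq with h | h
        · exact (not_le.1 fun h' => hgood ⟨h, h'⟩).le
        · have h0 : q.vec = (0 : ℂ) • s.vec := by simpa using h.symm
          rw [tangle_eq_of_vec_eq_smul h0, ← h]
          simp
      have h3 : 2 * S ≤ ‖q.vec‖ ^ 2 := by
        refine le_of_mul_le_mul_left ?_ hδ
        rw [← hδs] at h2
        linarith
      have h4 := mul_le_mul_of_nonneg_left h3 (by linarith : 0 ≤ s.interference + C)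
      have h5 := mul_le_mul_of_nonneg_right
        (by linarith : 2 / δ ^ 2 * 2 + s.interference ≤ C) hN
      linarith

end LOCC

end TripartiteLOCC

theorem mainTheorem9 (φi φs : TripartiteLOCC.ThreeQubit)
    (hi : TripartiteLOCC.IsGHZClass φi) (hs : TripartiteLOCC.IsGHZClass φs)
    (Ii Is : ℝ) (hIi : TripartiteLOCC.HasInterferenceTerm φi Ii)
    (hIs : TripartiteLOCC.HasInterferenceTerm φs Is) (hne : Ii ≠ Is) :
    ∃ c : ℝ, c < 1 ∧ ∀ P : TripartiteLOCC.LOCC, P.successProb φs φi ≤ c := by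
  obtain ⟨p, rfl, rfl, -⟩ := hIi.exists_pair hi
  obtain ⟨s, rfl, rfl, hT⟩ := hIs.exists_pair hs
  have hp1 := hi.1
  have hs1 := hs.1
  rcases hne.lt_or_gt with hlt | hgt
  · by_cases hgood : s.tangle / 2 ≤ p.tangle
    · set C := 2 / (s.tangle / 2) ^ 2 * 2 + |s.interference| with hC
      have hpos : 0 < s.interference + C := by
        have : 0 < 2 / (s.tangle / 2) ^ 2 * 2 := by positivity
        linarith [neg_abs_le s.interference]
      refine ⟨(p.interference + C) / (s.interference + C), ?_, fun P => ?_⟩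
      · rw [div_lt_one hpos]; linarith
      · have h := TripartiteLOCC.LOCC.le_interference_of_protocol hs1 (half_pos hT) (by ring) hC.ge P p
          (by simp [hp1]) (by simpa [hp1] using hgood)
        rw [hp1] at h
        rw [le_div_iff₀ hpos]
        linarith
    -- The initial tangle is already below half the target's, so monotonicity alone suffices.
    · refine ⟨1 / 2, by norm_num, fun P => ?_⟩
      have h := TripartiteLOCC.LOCC.successProb_mul_tangle_le hs1 P p
      refine le_of_mul_le_mul_right ?_ hT
      linarith
  · have hle := p.interference_le
    rw [hp1] at hle
    have hpos : 0 < 1 / 2 - s.interference := by linarith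
    refine ⟨(1 / 2 - p.interference) / (1 / 2 - s.interference), ?_, fun P => ?_⟩
    · rw [div_lt_one hpos]; linarith
    · have h := TripartiteLOCC.LOCC.interference_le_of_protocol hs1 hT P p
      rw [hp1] at h
      rw [le_div_iff₀ hpos]
      linarith
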